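/- Let $\mathcal X\subset\mathbb R^d$ be compact, $\mathcal Y=[-1,1]$, $K$ a Mercer kernel on $\mathcal X$ (continuous, symmetric, positive semidefinite) with RKHS $\mathcal H_K$ and norm $\|\cdot\|_K$, and $\rho$ a probability distribution on $\mathcal X\times\mathcal Y$ with marginal $\rho_{\mathcal X}$ on $\mathcal X$, such that $\|K(x,\cdot)\|_K\le 1$ for $\rho_{\mathcal X}$-almost every $x$. Let $\ell:\mathbb R\to[0,\infty)$ be convex and $L$-Lipschitz, $L>0$. For $f:\mathcal X\to\mathbb R$ put $\mathcal E^\ell(f)=\int \ell(yf(x))\,d\rho(x,y)$, and let $f^\ell_\rho$ be a measurable function with $f^\ell_\rho(x)\in\operatorname{argmin}_{t\in\mathbb R}\int\ell(yt)\,d\rho(y|x)$ for $\rho_{\mathcal X}$-almost every $x$ (assumed to exist). Suppose that for some $0<\beta\le 1$ and $C>0$ $$\inf_{f\in\mathcal H_K}\Big(\|f-f^\ell_\rho\|_{L^1(\rho_{\mathcal X})}+\gamma\|f\|_K^2\Big)\le C\gamma^\beta\qquad\text{for all }\gamma>0 .$$ Let $(x_t,y_t)_{t\ge1}$ be IID from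 $\rho$, and run the PiSTOL algorithm with parameters $b>0$ and $a\ge 2.25L$: start with $g_0=0\in\mathcal H_K$, $\alpha_0=aL$, and for $t=1,2,\dots$ set $$f_t=\frac{b}{\alpha_{t-1}}\exp\Big(\frac{\|g_{t-1}\|_K^2}{2\alpha_{t-1}}\Big)g_{t-1},\qquad g_t=g_{t-1}-s_tK(x_t,\cdot),\qquad \alpha_t=\alpha_{t-1}+a|s_t|\,\|K(x_t,\cdot)\|_K ,$$ where $s_t$ is any subgradient of $v\mapsto\ell(y_tv)$ at $f_t(x_t)$, chosen as a measurable function of $(x_1,y_1),\dots,(x_t,y_t)$. Let $\bar f_T=\frac1T\sum_{t=1}^Tf_t$. Then the risks $\mathcal E^\ell(f^\ell_\rho)$ and $\mathcal E^\ell(f)$, $f\in\mathcal H_K$, are finite, $\mathcal E^\ell(\bar f_T)$ is integrable, and $$\mathbb E[\mathcal E^\ell(\bar f_T)]-\mathcal E^\ell(f^\ell_\rho)\le\tilde{\mathcal O}\big(T^{-\frac{\beta}{\beta+1}}\big),$$ that is, there are constants $c\in\mathbb R$ and $p\in\mathbb N$, depending only on $\beta$, $C$, $L$, $a$, $b$ and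 $\ell(0)$, such that for all $T\ge1$ the left-hand side is at most $c\,(\log(1+T))^p\,T^{-\beta/(\beta+1)}$. -/

import Mathlib

open MeasureTheory ProbabilityTheory Finset
open scoped ENNReal

noncomputable section

/-- The label space `[-1, 1]`. -/
abbrev Label : Type := Set.Icc (-1 : ℝ) 1

instance instNonemptyLabel : Nonempty Label := ⟨⟨0, by norm_num⟩⟩

/-- `K` is a Mercer kernel on the topological space `X`: continuous, symmetric and
positive semidefinite. -/
structure IsMercerKernel {X : Type*} [TopologicalSpace X] (K : X → X → ℝ) : Prop where
  continuous : Continuous fun p : X × X => K p.1 p.2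
  symm : ∀ x x', K x x' = K x' x
  posSemidef : ∀ (n : ℕ) (x : Fin n → X) (c : Fin n → ℝ),
    0 ≤ ∑ i, ∑ j, c i * c j * K (x i) (x j)

/-- The kernel section `K(x, ·)`, as an element of the reproducing kernel Hilbert space `H`. -/
def kerSection {X : Type*} (H : Type*) [NormedAddCommGroup H] [InnerProductSpace ℝ H]
    [CompleteSpace H] [RKHS ℝ H X ℝ] (x : X) : H :=
  RKHS.kerFun H x 1

/-- The Hilbert space of functions `H` is the RKHS of the kernel `K`: the kernel section at `x`
(the element of `H` representing evaluation at `x`) is the function `K(x, ·)`. -/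
def IsRKHSOf {X : Type*} (H : Type*) [NormedAddCommGroup H] [InnerProductSpace ℝ H]
    [CompleteSpace H] [RKHS ℝ H X ℝ] (K : X → X → ℝ) : Prop :=
  ∀ x x' : X, kerSection H x x' = K x x'

/-- `s` is a subgradient of `φ : ℝ → ℝ` at `v`. -/
def IsSubgradient (φ : ℝ → ℝ) (v s : ℝ) : Prop :=
  ∀ u : ℝ, (u - v) * s ≤ φ u - φ v

section Risk

variable {X : Type*} [MeasurableSpace X]

/-- The `ℓ`-risk `∫ ℓ(y f(x)) dρ(x, y)`. -/
def lRisk (ℓ : ℝ → ℝ) (ρ : Measure (X × Label)) (f : X → ℝ) : ℝ :=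
  ∫ z, ℓ ((z.2 : ℝ) * f z.1) ∂ρ

/-- The `ℓ`-risk of `f` is finite (recall that the losses are nonnegative). -/
def FiniteRisk (ℓ : ℝ → ℝ) (ρ : Measure (X × Label)) (f : X → ℝ) : Prop :=
  Integrable (fun z : X × Label => ℓ ((z.2 : ℝ) * f z.1)) ρ

/-- `f` is a measurable version of `x ↦ argmin_t ∫ ℓ(y t) dρ(y | x)`. Conditional distributions
are determined up to null sets of the marginal, and so is `f` (if the minimizer is unique). -/
def IsOptimalPredictor (ℓ : ℝ → ℝ) (ρ : Measure (X × Label)) [IsFiniteMeasure ρ]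
    (f : X → ℝ) : Prop :=
  Measurable f ∧
    ∀ᵐ x ∂ρ.fst, IsMinOn (fun t : ℝ => ∫ y, ℓ ((y : ℝ) * t) ∂(ρ.condKernel x)) Set.univ (f x)

end Risk

section Algorithm

variable {H : Type*} [NormedAddCommGroup H] [InnerProductSpace ℝ H]

/-- The internal state `(g_t, α_t)` of the PiSTOL algorithm with parameters `a, L`, after the
first `t` rounds, where `k i` is the kernel section at the input of round `i` and `s i` is the
subgradient received in round `i`. Rounds are numbered from `0`. -/
def pistolState (a L : ℝ) (k : ℕ → H) (s : ℕ → ℝ) : ℕ → H × ℝ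
  | 0 => (0, a * L)
  | t + 1 =>
    ((pistolState a L k s t).1 - s t • k t,
      (pistolState a L k s t).2 + a * |s t| * ‖k t‖)

/-- The predictor that PiSTOL uses in round `t` (rounds numbered from `0`). -/
def pistolIterate (a b L : ℝ) (k : ℕ → H) (s : ℕ → ℝ) (t : ℕ) : H :=
  (b / (pistolState a L k s t).2 *
      Real.exp (‖(pistolState a L k s t).1‖ ^ 2 / (2 * (pistolState a L k s t).2))) •
    (pistolState a L k s t).1

/-- The averaged solution of PiSTOL after `T` rounds. -/
def pistolAverage (a b L : ℝ) (k : ℕ → H) (s : ℕ → ℝ) (T : ℕ) : H :=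
  (T : ℝ)⁻¹ • ∑ t ∈ range T, pistolIterate a b L k s t

end Algorithm

/-- The sequence of `ω`-dependent numbers `s` is an admissible sequence of subgradients for PiSTOL
run on the random sequence `z` of examples with the losses `ℓ_t(v) = ℓ(y_t v)`: in round `t` it
is a subgradient of `ℓ_t` at the current prediction, and it is a measurable function of the
examples seen up to and including round `t`. -/
structure IsSubgradientSequence {X H Ω : Type*} [MeasurableSpace X] [NormedAddCommGroup H]
    [InnerProductSpace ℝ H] [CompleteSpace H] [RKHS ℝ H X ℝ]
    (ℓ : ℝ → ℝ) (a b L : ℝ) (z : ℕ → Ω → X × Label) (s : ℕ → Ω → ℝ) : Prop where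
  subgradient : ∀ t ω, IsSubgradient (fun v => ℓ (((z t ω).2 : ℝ) * v))
    (pistolIterate a b L (fun i => kerSection H (z i ω).1) (fun i => s i ω) t (z t ω).1) (s t ω)
  nonanticipating : ∀ t,
    Measurable[⨆ i ∈ Set.Iic t, MeasurableSpace.comap (z i) inferInstance] (s t)

/-- The averaged solution returned by PiSTOL after `T` rounds on the random sequence `z` of
examples with subgradients `s`. -/
def pistolSolution {X Ω : Type*} (H : Type*) [NormedAddCommGroup H] [InnerProductSpace ℝ H]
    [CompleteSpace H] [RKHS ℝ H X ℝ]
    (a b L : ℝ) (z : ℕ → Ω → X × Label) (s : ℕ → Ω → ℝ) (T : ℕ) (ω : Ω) : H :=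
  pistolAverage a b L (fun i => kerSection H (z i ω).1) (fun i => s i ω) T

end

/-! The potential `b * exp (‖g‖² / (2α))` plays the role of the learner's wealth, and the iterate
`f_t` is its gradient in `g` at `(g_{t-1}, α_{t-1})`. Hence the linear term of each update is
exactly `-s_t ⟪k_t, f_t⟫`. The growth of `α` absorbs the second-order term up to an error of order
`log α_t - log α_{t-1}`, so the errors telescope to `O(log T)` (`exp_norm_add_sq_le`,
`pistol_potential_le`). A large potential pays for the term `⟪g, h⟫` of any competitor `h`, which
gives regret of order `‖h‖ √(T log T) + log T` with no tuning to `‖h‖` (`pistol_regret_le`). Since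
`f_t` depends only on examples independent of the `t`-th one, the expected online loss of `f_t` is
its expected risk. Convexity then passes the bound to the average. Finally `h` is a near-minimizer
of the regularized approximation error at `γ = T^(-1/(β+1))`. This choice balances the approximation
error `γ^β` against `‖h‖ / √T`, which is of order `γ^((β-1)/2) T^(-1/2)`. -/

/-! ### Scalar inequalities for the exponential potential. -/

lemma exp_sub_sq_le_one_add {p : ℝ} (hp : |p| ≤ 4 / 9) : Real.exp (p - p ^ 2) ≤ 1 + p := by
  obtain ⟨h1, h2⟩ := abs_le.1 hp
  rcases le_total 0 p with h0 | h0
  · have hw : |p - p ^ 2| ≤ 1 := abs_le.2 ⟨by nlinarith, by nlinarith⟩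
    have h3 := (abs_le.1 (Real.abs_exp_sub_one_sub_id_le hw)).2
    nlinarith [mul_nonneg (sq_nonneg p) h0, mul_nonneg (sq_nonneg p) (mul_nonneg h0 (sub_nonneg.2 h2))]
  · obtain ⟨q, rfl⟩ : ∃ q, p = -q := ⟨-p, by ring⟩
    have hq0 : 0 ≤ q := by linarith
    have hq1 : q ≤ 4 / 9 := by linarith
    have hw : 0 ≤ q + q ^ 2 := by positivity
    have h3 := Real.quadratic_le_exp_of_nonneg hw
    have h4 : Real.exp (-q - (-q) ^ 2) * Real.exp (q + q ^ 2) = 1 := by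
      rw [← Real.exp_add]; ring_nf; exact Real.exp_zero
    have h5 : 1 ≤ (1 + -q) * (1 + (q + q ^ 2) + (q + q ^ 2) ^ 2 / 2) := by
      have h6 : 0 ≤ 1 / 2 - q / 2 - q ^ 2 / 2 - q ^ 3 / 2 := by
        have h7 : q ^ 2 ≤ (4 / 9) ^ 2 := by gcongr
        have h8 : q ^ 3 ≤ (4 / 9) ^ 3 := by gcongr
        norm_num at h7 h8
        linarith
      nlinarith [mul_nonneg (sq_nonneg q) h6]
    have h6 : 1 ≤ (1 + -q) * Real.exp (q + q ^ 2) :=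
      h5.trans (mul_le_mul_of_nonneg_left h3 (by linarith))
    refine le_of_mul_le_mul_right ?_ (Real.exp_pos (q + q ^ 2))
    rwa [h4]

/-- One step of the exponential potential, after normalization by the current scale. -/
lemma exp_potential_step {τ u p R : ℝ} (hτ0 : 0 ≤ τ) (hu0 : 0 ≤ u)
    (hu1 : u ≤ 4 / 9) (hR : 0 ≤ R) (hτR : τ * R ≤ u) (hτ1 : τ ≤ 1) (hp : p ^ 2 ≤ u * (τ * R)) :
    Real.exp ((R / 2 + p + τ * u / 2) / (1 + τ))
      ≤ Real.exp (R / 2) * (1 + p) + 30 * Real.exp 16 * τ := by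
  have hp' : |p| ≤ 4 / 9 := by
    refine abs_le_of_sq_le_sq ?_ (by norm_num)
    nlinarith
  obtain ⟨hp1, hp2⟩ := abs_le.1 hp'
  have h1τ : 0 < 1 + τ := by linarith
  have hτu : τ * u ≤ τ * (4 / 9) := mul_le_mul_of_nonneg_left hu1 hτ0
  have hpl : -(τ * p) ≤ τ * (4 / 9) := by nlinarith
  have hs : 0 ≤ τ * R := by positivity
  have hps : p ^ 2 ≤ 4 / 9 * (τ * R) := hp.trans (mul_le_mul_of_nonneg_right hu1 hs)
  -- For `R ≥ 32`, dividing by `1 + τ` costs about `τR/2`. This covers `p² ≤ (4/9)τR` and leaves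
  -- `τR/18`, enough for the remaining terms of order `τ`, so no additive error arises.
  rcases le_total 32 R with h32 | h32
  · have h32' : τ * 32 ≤ τ * R := mul_le_mul_of_nonneg_left h32 hτ0
    have hτs : τ ≤ 1 / 72 := by linarith
    have key : (R / 2 + p + τ * u / 2) / (1 + τ) ≤ R / 2 + (p - p ^ 2) := by
      rw [div_le_iff₀ h1τ]
      have : τ * p ^ 2 ≤ 1 / 72 * p ^ 2 := mul_le_mul_of_nonneg_right hτs (sq_nonneg p)
      nlinarith
    calc _ ≤ Real.exp (R / 2 + (p - p ^ 2)) := Real.exp_le_exp.2 key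
      _ = Real.exp (R / 2) * Real.exp (p - p ^ 2) := Real.exp_add _ _
      _ ≤ Real.exp (R / 2) * (1 + p) := by
        gcongr
        exact exp_sub_sq_le_one_add hp'
      _ ≤ _ := le_add_of_nonneg_right (by positivity)
  · have h32' : τ * R ≤ τ * 32 := mul_le_mul_of_nonneg_left h32 hτ0
    -- For `R ≤ 32` the factor `exp (R / 2)` is at most `exp 16`, and `v²` is itself of order `τ`.
    -- The expansion `exp v ≤ 1 + v + v²` therefore costs at most `30τ`.
    set v := (p + τ * u / 2) / (1 + τ) with hv
    have hve : v * (1 + τ) = p + τ * u / 2 := div_mul_cancel₀ _ h1τ.ne'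
    have hτu0 : 0 ≤ τ * u := mul_nonneg hτ0 hu0
    have hτu1 : τ * u ≤ 4 / 9 := by linarith
    have hvabs : |v| ≤ |p + τ * u / 2| := by
      rw [hv, abs_div, abs_of_pos h1τ]
      exact div_le_self (abs_nonneg _) (by linarith)
    have hv1 : |v| ≤ 1 := hvabs.trans (abs_le.2 ⟨by linarith, by linarith⟩)
    have hv2 : v ^ 2 ≤ (p + τ * u / 2) ^ 2 := sq_le_sq.2 hvabs
    have hv3 : (p + τ * u / 2) ^ 2 ≤ 2 * p ^ 2 + τ * u := by
      nlinarith [sq_nonneg (p - τ * u / 2)]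
    have hvp : v ≤ p + τ * (2 / 3) := by
      rw [hv, div_le_iff₀ h1τ]
      nlinarith [mul_nonneg hτ0 hτ0]
    have hexp := (abs_le.1 (Real.abs_exp_sub_one_sub_id_le hv1)).2
    have hexp' : Real.exp v ≤ 1 + p + 30 * τ := by linarith
    calc Real.exp ((R / 2 + p + τ * u / 2) / (1 + τ)) ≤ Real.exp (R / 2 + v) := by
          refine Real.exp_le_exp.2 ?_
          rw [div_le_iff₀ h1τ, add_mul, hve]
          nlinarith
      _ = Real.exp (R / 2) * Real.exp v := Real.exp_add _ _
      _ ≤ Real.exp (R / 2) * (1 + p + 30 * τ) := by gcongr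
      _ = Real.exp (R / 2) * (1 + p) + 30 * Real.exp (R / 2) * τ := by ring
      _ ≤ _ := by gcongr; linarith

/-! ### Deterministic regret of PiSTOL in a Hilbert space. -/

section Algorithm

variable {H : Type*} [NormedAddCommGroup H] [InnerProductSpace ℝ H]

open scoped RealInnerProductSpace

/-- With `τ = a‖x‖/α`, `u = ‖x‖/a` and `R = ‖w‖²/α`, this is `exp_potential_step`. The condition `a
≥ 2.25 L` makes `u ≤ 4/9`, and Cauchy–Schwarz bounds the square of the linear term by `u τ R`. -/
lemma exp_norm_add_sq_le {a L α : ℝ} (hL : 0 < L) (ha : 2.25 * L ≤ a) (hα : a * L ≤ α)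
    {w x : H} (hx : ‖x‖ ≤ L) (hw : a * ‖w‖ ≤ α) :
    Real.exp (‖w + x‖ ^ 2 / (2 * (α + a * ‖x‖)))
      ≤ Real.exp (‖w‖ ^ 2 / (2 * α)) * (1 + ⟪x, w⟫ / α)
        + 60 * Real.exp 16 * (Real.log (α + a * ‖x‖) - Real.log α) := by
  norm_num at ha
  have ha0 : 0 < a := by linarith
  have hα0 : 0 < α := (mul_pos ha0 hL).trans_le hα
  set τ := a * ‖x‖ / α with hτ
  set u := ‖x‖ / a with hu
  set R := ‖w‖ ^ 2 / α with hR
  have hτ0 : 0 ≤ τ := by positivity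
  have hτ1 : τ ≤ 1 := by
    rw [hτ, div_le_one hα0]
    exact (mul_le_mul_of_nonneg_left hx ha0.le).trans hα
  have huτ : u * τ = ‖x‖ ^ 2 / α := by rw [hu, hτ]; field_simp
  have h1 : τ * R ≤ u := by
    have : (a * ‖w‖) ^ 2 ≤ α ^ 2 := by gcongr
    have e : τ * R = (a * ‖w‖) ^ 2 / α ^ 2 * u := by rw [hτ, hR, hu]; field_simp
    rw [e]
    exact mul_le_of_le_one_left (by positivity) ((div_le_one (by positivity)).2 this)
  have h2 : (⟪x, w⟫ / α) ^ 2 ≤ u * (τ * R) := by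
    rw [← mul_assoc, huτ, hR, div_pow, div_mul_div_comm, ← pow_two α]
    gcongr
    rw [← mul_pow]
    exact sq_le_sq.2 ((abs_real_inner_le_norm x w).trans (le_abs_self _))
  have h3 := exp_potential_step hτ0 (by positivity : 0 ≤ u)
    ((div_le_iff₀ ha0).2 (by linarith)) (by positivity : 0 ≤ R) h1 hτ1 h2
  have hατ : α + a * ‖x‖ = α * (1 + τ) := by rw [hτ]; field_simp
  have e1 : ‖w + x‖ ^ 2 / (2 * (α + a * ‖x‖)) = (R / 2 + ⟪x, w⟫ / α + τ * u / 2) / (1 + τ) := by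
    rw [hατ, norm_add_sq_real, mul_comm τ u, huτ, hR, real_inner_comm]
    field_simp
  have e2 : ‖w‖ ^ 2 / (2 * α) = R / 2 := by rw [hR]; field_simp
  rw [e1, e2, hατ, Real.log_mul hα0.ne' (by positivity)]
  refine h3.trans ?_
  -- Turns the error `τ` into an increment of `log α`, which telescopes over the rounds; this
  -- doubles the constant 30 to 60.
  have h4 : τ ≤ 2 * Real.log (1 + τ) := by
    have h5 := Real.one_sub_inv_le_log_of_pos (show 0 < 1 + τ by linarith)
    have h6 : τ / 2 ≤ 1 - (1 + τ)⁻¹ := by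
      rw [← sub_nonneg]
      have : 1 - (1 + τ)⁻¹ - τ / 2 = τ * (1 - τ) / (2 * (1 + τ)) := by field_simp; ring
      rw [this]
      exact div_nonneg (mul_nonneg hτ0 (by linarith)) (by linarith)
    linarith
  have := mul_le_mul_of_nonneg_left h4 (show 0 ≤ 30 * Real.exp 16 by positivity)
  linarith

variable {a b L : ℝ} {k : ℕ → H} {s : ℕ → ℝ}

/-- Each round moves `g` by at most `|s t| ‖k t‖` while `α` grows by `a` times that amount, so `α`
always dominates `a‖g‖`, as the potential step needs. -/
lemma pistolState_bounds (ha : 0 < a) (hL : 0 < L) (T : ℕ) (hk : ∀ t < T, ‖k t‖ ≤ 1)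
    (hs : ∀ t < T, |s t| ≤ L) :
    a * L ≤ (pistolState a L k s T).2 ∧
      a * ‖(pistolState a L k s T).1‖ ≤ (pistolState a L k s T).2 - a * L ∧
      (pistolState a L k s T).2 ≤ a * L * (1 + T) ∧
      ‖(pistolState a L k s T).1‖ ≤ L * T := by
  induction T with
  | zero => simp [pistolState]
  | succ t ih =>
    obtain ⟨h1, h2, h3, h4⟩ := ih (fun i hi => hk i (by omega)) (fun i hi => hs i (by omega))
    have hsk : |s t| * ‖k t‖ ≤ L := by
      calc |s t| * ‖k t‖ ≤ L * 1 :=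
            mul_le_mul (hs t (by omega)) (hk t (by omega)) (norm_nonneg _) hL.le
        _ = L := mul_one L
    have hask := mul_le_mul_of_nonneg_left hsk ha.le
    have h5 : ‖(pistolState a L k s t).1 - s t • k t‖
        ≤ ‖(pistolState a L k s t).1‖ + |s t| * ‖k t‖ :=
      (norm_sub_le _ _).trans_eq (by rw [norm_smul, Real.norm_eq_abs])
    have h6 := mul_le_mul_of_nonneg_left h5 ha.le
    have h7 : 0 ≤ a * |s t| * ‖k t‖ := by positivity
    simp only [pistolState]
    push_cast
    refine ⟨?_, ?_, ?_, ?_⟩ <;> nlinarith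

lemma norm_pistolIterate_le (ha : 0 < a) (hL : 0 < L) (hb : 0 < b) (t : ℕ)
    (hk : ∀ i < t, ‖k i‖ ≤ 1) (hs : ∀ i < t, |s i| ≤ L) :
    ‖pistolIterate a b L k s t‖
      ≤ b / (a * L) * Real.exp ((L * t) ^ 2 / (2 * (a * L))) * (L * t) := by
  obtain ⟨h1, -, -, h4⟩ := pistolState_bounds ha hL t hk hs
  have haL : 0 < a * L := mul_pos ha hL
  have hα := haL.trans_le h1
  rw [pistolIterate, norm_smul, Real.norm_of_nonneg (by positivity)]
  gcongr

/-- The scale factor in `pistolIterate` makes `s t * ⟪k t, f_t⟫` cancel the linear term of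
`exp_norm_add_sq_le` at `x = -(s t • k t)`. -/
lemma pistol_potential_le (hL : 0 < L) (ha : 2.25 * L ≤ a) (hb : 0 < b) (T : ℕ)
    (hk : ∀ t < T, ‖k t‖ ≤ 1) (hs : ∀ t < T, |s t| ≤ L) :
    b * Real.exp (‖(pistolState a L k s T).1‖ ^ 2 / (2 * (pistolState a L k s T).2))
      ≤ b - ∑ t ∈ range T, s t * ⟪k t, pistolIterate a b L k s t⟫
        + 60 * Real.exp 16 * b *
          (Real.log (pistolState a L k s T).2 - Real.log (a * L)) := by
  have ha0 : 0 < a := by norm_num at ha; linarith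
  induction T with
  | zero => simp [pistolState]
  | succ t ih =>
    have ih := ih (fun i hi => hk i (by omega)) (fun i hi => hs i (by omega))
    obtain ⟨h1, h2, -, -⟩ := pistolState_bounds ha0 hL t
      (fun i hi => hk i (by omega)) (fun i hi => hs i (by omega))
    have hn : ‖-(s t • k t)‖ = |s t| * ‖k t‖ := by rw [norm_neg, norm_smul, Real.norm_eq_abs]
    have hx : ‖-(s t • k t)‖ ≤ L := by
      rw [hn]
      calc |s t| * ‖k t‖ ≤ L * 1 :=
            mul_le_mul (hs t (by omega)) (hk t (by omega)) (norm_nonneg _) hL.le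
        _ = L := mul_one L
    have haL := mul_pos ha0 hL
    have step := exp_norm_add_sq_le hL ha h1 hx (h2.trans (by linarith))
    rw [hn, ← mul_assoc, ← sub_eq_add_neg] at step
    have step' := mul_le_mul_of_nonneg_left step hb.le
    rw [sum_range_succ]
    simp only [pistolState]
    have e : s t * ⟪k t, pistolIterate a b L k s t⟫
        = -(b * (Real.exp (‖(pistolState a L k s t).1‖ ^ 2 / (2 * (pistolState a L k s t).2))
          * (⟪-(s t • k t), (pistolState a L k s t).1⟫ / (pistolState a L k s t).2))) := by
      rw [pistolIterate, inner_smul_right, inner_neg_left, real_inner_smul_left]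
      ring
    rw [e]
    linarith

lemma pistolState_fst_eq (T : ℕ) :
    (pistolState a L k s T).1 = -∑ t ∈ range T, s t • k t := by
  induction T with
  | zero => simp [pistolState]
  | succ t ih => simp only [pistolState, ih, sum_range_succ]; abel

lemma pistolState_snd_eq (T : ℕ) :
    (pistolState a L k s T).2 = a * L + ∑ t ∈ range T, a * |s t| * ‖k t‖ := by
  induction T with
  | zero => simp [pistolState]
  | succ t ih => simp only [pistolState, ih, sum_range_succ]; ring

/-- The bound on the regret of PiSTOL over `T` rounds against a competitor of norm `U`. -/
noncomputable def pistolRegretBound (a b L : ℝ) (T : ℕ) (U : ℝ) : ℝ :=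
  b + 60 * Real.exp 16 * b * Real.log (1 + T)
    + U * √(2 * (a * L * (1 + T)) * Real.log (1 + U * (L * T) / b))

/-- The linearized regret bound of PiSTOL. -/
lemma pistol_regret_le (hL : 0 < L) (ha : 2.25 * L ≤ a) (hb : 0 < b) (T : ℕ)
    (hk : ∀ t < T, ‖k t‖ ≤ 1) (hs : ∀ t < T, |s t| ≤ L) (h : H) :
    ∑ t ∈ range T, s t * (⟪k t, pistolIterate a b L k s t⟫ - ⟪k t, h⟫)
      ≤ pistolRegretBound a b L T ‖h‖ := by
  have ha0 : 0 < a := by norm_num at ha; linarith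
  have haL := mul_pos ha0 hL
  obtain ⟨h1, h2, h3, h4⟩ := pistolState_bounds ha0 hL T hk hs
  have hpot := pistol_potential_le hL ha hb T hk hs
  set g := (pistolState a L k s T).1 with hg
  set α := (pistolState a L k s T).2 with hα
  have hα0 := haL.trans_le h1
  have hlin : ∑ t ∈ range T, s t * ⟪k t, h⟫ = -⟪g, h⟫ := by
    rw [hg, pistolState_fst_eq, inner_neg_left, sum_inner, neg_neg]
    simp only [real_inner_smul_left]
  have hlog : Real.log α - Real.log (a * L) ≤ Real.log (1 + T) := by
    have h5 := Real.log_le_log hα0 h3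
    rw [Real.log_mul haL.ne' (by positivity)] at h5
    linarith
  have hlog' := mul_le_mul_of_nonneg_left hlog (show 0 ≤ 60 * Real.exp 16 * b by positivity)
  have hcs : ⟪g, h⟫ ≤ ‖h‖ * ‖g‖ := (real_inner_le_norm g h).trans_eq (mul_comm _ _)
  set M := Real.log (1 + ‖h‖ * (L * T) / b) with hM
  have hq : 0 ≤ ‖h‖ * (L * T) / b := by positivity
  have hM0 : 0 ≤ M := Real.log_nonneg (by linarith)
  have hdual : ‖h‖ * ‖g‖ ≤ b * Real.exp (‖g‖ ^ 2 / (2 * α))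
      + ‖h‖ * √(2 * (a * L * (1 + T)) * M) := by
    -- This dichotomy replaces the Fenchel conjugate of the potential. Either `‖g‖` is below the
    -- square root, or the potential is already at least `b + ‖h‖ L T`, hence at least `‖h‖ ‖g‖`.
    rcases le_total (‖g‖ ^ 2) (2 * α * M) with hc | hc
    · have : ‖g‖ ≤ √(2 * (a * L * (1 + T)) * M) := by
        refine Real.le_sqrt_of_sq_le (hc.trans ?_)
        gcongr
      have := mul_le_mul_of_nonneg_left this (norm_nonneg h)
      have : 0 ≤ b * Real.exp (‖g‖ ^ 2 / (2 * α)) := by positivity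
      linarith
    · have h5 : M ≤ ‖g‖ ^ 2 / (2 * α) := by
        rw [le_div_iff₀ (by positivity)]
        linarith
      have h6 : 1 + ‖h‖ * (L * T) / b ≤ Real.exp (‖g‖ ^ 2 / (2 * α)) :=
        (Real.log_le_iff_le_exp (by positivity)).1 h5
      have h7 : ‖h‖ * ‖g‖ ≤ b * (‖h‖ * (L * T) / b) := by
        rw [mul_div_cancel₀ _ hb.ne']
        gcongr
      have h8 := mul_le_mul_of_nonneg_left h6 hb.le
      have : 0 ≤ ‖h‖ * √(2 * (a * L * (1 + T)) * M) := by positivity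
      linarith
  simp only [mul_sub, sum_sub_distrib]
  rw [hlin, pistolRegretBound]
  linarith

end Algorithm

/-! ### Reproducing property, continuity and measurability in the RKHS. -/

section RKHSFacts

open scoped RealInnerProductSpace

variable {X H : Type*} [NormedAddCommGroup H] [InnerProductSpace ℝ H] [CompleteSpace H]
  [RKHS ℝ H X ℝ] {K : X → X → ℝ}

lemma inner_kerSection (x : X) (f : H) : ⟪kerSection H x, f⟫ = f x := by
  rw [kerSection, RKHS.kerFun_inner]
  simp

lemma abs_apply_le_norm_mul (x : X) (f : H) : |f x| ≤ ‖kerSection H x‖ * ‖f‖ := by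
  rw [← inner_kerSection]
  exact abs_real_inner_le_norm _ _

lemma IsRKHSOf.inner_kerSection_kerSection (hK : IsRKHSOf H K) (x y : X) :
    ⟪kerSection H x, kerSection H y⟫ = K y x := by
  rw [inner_kerSection, hK]

lemma IsRKHSOf.norm_kerSection (hK : IsRKHSOf H K) (x : X) :
    ‖kerSection H x‖ = √(K x x) := by
  rw [← hK.inner_kerSection_kerSection, real_inner_self_eq_norm_sq, Real.sqrt_sq (norm_nonneg _)]

lemma IsRKHSOf.continuous_kerSection [TopologicalSpace X] (hK : IsRKHSOf H K)
    (hM : IsMercerKernel K) : Continuous (kerSection H : X → H) := by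
  rw [continuous_iff_continuousAt]
  intro x
  rw [ContinuousAt, tendsto_iff_norm_sub_tendsto_zero]
  have e : ∀ y, ‖kerSection H y - kerSection H x‖ = √(K y y - 2 * K x y + K x x) := by
    intro y
    rw [← Real.sqrt_sq (norm_nonneg (kerSection H y - kerSection H x)), norm_sub_sq_real,
      ← real_inner_self_eq_norm_sq, ← real_inner_self_eq_norm_sq]
    simp only [hK.inner_kerSection_kerSection]
  simp only [e]
  have hc := hM.continuous
  have h1 : Continuous fun y => √(K y y - 2 * K x y + K x x) := by
    have h2 : Continuous fun y => K y y := hc.comp (continuous_id.prodMk continuous_id)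
    have h3 : Continuous fun y => K x y := hc.comp (continuous_const.prodMk continuous_id)
    fun_prop
  have h4 := h1.tendsto x
  have h5 : K x x - 2 * K x x + K x x = 0 := by ring
  rwa [h5, Real.sqrt_zero] at h4

lemma IsRKHSOf.continuous_apply [TopologicalSpace X] (hK : IsRKHSOf H K)
    (hM : IsMercerKernel K) (f : H) : Continuous (f : X → ℝ) := by
  have h := hK.continuous_kerSection hM
  have e : (f : X → ℝ) = fun x => ⟪kerSection H x, f⟫ := funext fun x => (inner_kerSection x f).symm
  rw [e]
  fun_prop

lemma IsMercerKernel.measurable [TopologicalSpace X] [SecondCountableTopology X]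
    [MeasurableSpace X] [BorelSpace X] (hM : IsMercerKernel K) :
    Measurable fun p : X × X => K p.1 p.2 :=
  hM.continuous.measurable

lemma IsRKHSOf.pistolState_apply (hK : IsRKHSOf H K) (a L : ℝ) (ξ : ℕ → X) (s : ℕ → ℝ) (t : ℕ)
    (x : X) : (pistolState a L (fun i => kerSection H (ξ i)) s t).1 x
      = -∑ i ∈ range t, s i * K (ξ i) x := by
  rw [← inner_kerSection, pistolState_fst_eq, inner_neg_right, inner_sum]
  simp only [real_inner_smul_right, hK.inner_kerSection_kerSection]

lemma IsRKHSOf.norm_sq_pistolState (hK : IsRKHSOf H K) (a L : ℝ) (ξ : ℕ → X) (s : ℕ → ℝ) (t : ℕ) :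
    ‖(pistolState a L (fun i => kerSection H (ξ i)) s t).1‖ ^ 2
      = ∑ j ∈ range t, s j * ∑ i ∈ range t, s i * K (ξ i) (ξ j) := by
  rw [← real_inner_self_eq_norm_sq]
  nth_rewrite 1 [pistolState_fst_eq]
  rw [inner_neg_left, sum_inner]
  simp only [real_inner_smul_left, inner_kerSection, hK.pistolState_apply, mul_neg, sum_neg_distrib,
    neg_neg]

lemma IsRKHSOf.pistolState_snd (hK : IsRKHSOf H K) (a L : ℝ) (ξ : ℕ → X) (s : ℕ → ℝ) (t : ℕ) :
    (pistolState a L (fun i => kerSection H (ξ i)) s t).2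
      = a * L + ∑ i ∈ range t, a * |s i| * √(K (ξ i) (ξ i)) := by
  simp only [pistolState_snd_eq, hK.norm_kerSection]

/-- Every ingredient of the iterate is a finite expression in kernel values and subgradients, so no
σ-algebra on `H` is needed. Only rounds before `t` enter, so the lemma also applies with the
σ-algebra of the past on `Ω`. -/
lemma IsRKHSOf.measurable_pistolIterate_apply [TopologicalSpace X] [SecondCountableTopology X]
    [MeasurableSpace X] [BorelSpace X] {Ω : Type*} [MeasurableSpace Ω] (hK : IsRKHSOf H K)
    (hM : IsMercerKernel K) (a b L : ℝ) {ξ : ℕ → Ω → X} {s : ℕ → Ω → ℝ} {t : ℕ}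
    (hξ : ∀ i < t, Measurable (ξ i)) (hs : ∀ i < t, Measurable (s i)) :
    Measurable fun p : Ω × X =>
      pistolIterate a b L (fun i => kerSection H (ξ i p.1)) (fun i => s i p.1) t p.2 := by
  have hKm := hM.measurable
  have hα : Measurable fun p : Ω × X =>
      (pistolState a L (fun i => kerSection H (ξ i p.1)) (fun i => s i p.1) t).2 := by
    simp only [hK.pistolState_snd]
    refine measurable_const.add (Finset.measurable_sum _ fun i hi => ?_)
    have h2 : Measurable fun p : Ω × X => ξ i p.1 := (hξ i (mem_range.1 hi)).comp measurable_fst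
    have h4 : Measurable fun p : Ω × X => |s i p.1| :=
      ((hs i (mem_range.1 hi)).comp measurable_fst).abs
    exact (h4.const_mul a).mul (hKm.comp (h2.prodMk h2)).sqrt
  have hN : Measurable fun p : Ω × X =>
      ‖(pistolState a L (fun i => kerSection H (ξ i p.1)) (fun i => s i p.1) t).1‖ ^ 2 := by
    simp only [hK.norm_sq_pistolState]
    refine Finset.measurable_sum _ fun j hj => ?_
    refine ((hs j (mem_range.1 hj)).comp measurable_fst).mul
      (Finset.measurable_sum _ fun i hi => ?_)
    exact ((hs i (mem_range.1 hi)).comp measurable_fst).mul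
      (hKm.comp (((hξ i (mem_range.1 hi)).comp measurable_fst).prodMk
        ((hξ j (mem_range.1 hj)).comp measurable_fst)))
  have hg : Measurable fun p : Ω × X =>
      (pistolState a L (fun i => kerSection H (ξ i p.1)) (fun i => s i p.1) t).1 p.2 := by
    simp only [hK.pistolState_apply]
    refine (Finset.measurable_sum _ fun i hi => ?_).neg
    exact ((hs i (mem_range.1 hi)).comp measurable_fst).mul
      (hKm.comp (((hξ i (mem_range.1 hi)).comp measurable_fst).prodMk measurable_snd))
  have e : ∀ p : Ω × X,
      pistolIterate a b L (fun i => kerSection H (ξ i p.1)) (fun i => s i p.1) t p.2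
      = b / (pistolState a L (fun i => kerSection H (ξ i p.1)) (fun i => s i p.1) t).2 *
        Real.exp (‖(pistolState a L (fun i => kerSection H (ξ i p.1)) (fun i => s i p.1) t).1‖ ^ 2
          / (2 * (pistolState a L (fun i => kerSection H (ξ i p.1)) (fun i => s i p.1) t).2)) *
        (pistolState a L (fun i => kerSection H (ξ i p.1)) (fun i => s i p.1) t).1 p.2 := by
    intro p
    rw [pistolIterate, ← inner_kerSection, real_inner_smul_right, inner_kerSection]
  simp only [e]
  exact ((hα.const_div b).mul (hN.div (hα.const_mul 2)).exp).mul hg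

lemma pistolAverage_apply (a b L : ℝ) (k : ℕ → H) (s : ℕ → ℝ) (T : ℕ) (x : X) :
    pistolAverage a b L k s T x = ∑ t ∈ range T, (T : ℝ)⁻¹ • pistolIterate a b L k s t x := by
  rw [pistolAverage, ← inner_kerSection, real_inner_smul_right, inner_sum, mul_sum]
  simp only [inner_kerSection, smul_eq_mul]

end RKHSFacts

/-! ### Lipschitz losses and finiteness of risks. -/

section Loss

variable {X : Type*} [MeasurableSpace X] {ℓ : ℝ → ℝ} {L : ℝ} {ρ : Measure (X × Label)}

lemma continuous_of_abs_sub_le (hℓL : ∀ v v', |ℓ v - ℓ v'| ≤ L * |v - v'|) : Continuous ℓ :=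
  (LipschitzWith.of_dist_le' (K := L) fun x y => by simpa [Real.dist_eq] using hℓL x y).continuous

lemma abs_label_le (y : Label) : |(y : ℝ)| ≤ 1 := abs_le.2 ⟨y.2.1, y.2.2⟩

lemma abs_loss_sub_le (hL : 0 ≤ L) (hℓL : ∀ v v', |ℓ v - ℓ v'| ≤ L * |v - v'|) (y : Label)
    (u v : ℝ) : |ℓ (y * u) - ℓ (y * v)| ≤ L * |u - v| := by
  refine (hℓL _ _).trans (mul_le_mul_of_nonneg_left ?_ hL)
  rw [← mul_sub, abs_mul]
  exact mul_le_of_le_one_left (abs_nonneg _) (abs_label_le y)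

lemma loss_le (hL : 0 ≤ L) (hℓL : ∀ v v', |ℓ v - ℓ v'| ≤ L * |v - v'|) (y : Label)
    {v B : ℝ} (hv : |v| ≤ B) : ℓ (y * v) ≤ ℓ 0 + L * B := by
  have h := (abs_le.1 (abs_loss_sub_le hL hℓL y v 0)).2
  rw [mul_zero, sub_zero] at h
  linarith [mul_le_mul_of_nonneg_left hv hL]

lemma IsSubgradient.abs_le (hL : 0 ≤ L) (hℓL : ∀ v v', |ℓ v - ℓ v'| ≤ L * |v - v'|) {y : Label}
    {v s : ℝ} (hs : IsSubgradient (fun v => ℓ (y * v)) v s) : |s| ≤ L := by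
  have h1 := hs (v + 1)
  have h2 := hs (v - 1)
  have h3 := abs_loss_sub_le hL hℓL y (v + 1) v
  have h4 := abs_loss_sub_le hL hℓL y (v - 1) v
  simp only [add_sub_cancel_left, sub_sub_cancel_left, abs_neg, abs_one, mul_one, one_mul] at h1 h2 h3 h4
  have := le_of_abs_le h3
  have := le_of_abs_le h4
  exact _root_.abs_le.2 ⟨by linarith, by linarith⟩

lemma measurable_loss (hℓL : ∀ v v', |ℓ v - ℓ v'| ≤ L * |v - v'|) {f : X → ℝ}
    (hf : Measurable f) : Measurable fun z : X × Label => ℓ ((z.2 : ℝ) * f z.1) :=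
  (continuous_of_abs_sub_le hℓL).measurable.comp
    ((measurable_subtype_coe.comp measurable_snd).mul (hf.comp measurable_fst))

lemma finiteRisk_of_ae_abs_le [IsFiniteMeasure ρ] (hL : 0 ≤ L) (hℓ0 : ∀ v, 0 ≤ ℓ v)
    (hℓL : ∀ v v', |ℓ v - ℓ v'| ≤ L * |v - v'|) {f : X → ℝ} (hf : Measurable f) {B : ℝ}
    (hB : ∀ᵐ x ∂ρ.fst, |f x| ≤ B) : FiniteRisk ℓ ρ f := by
  refine Integrable.of_bound (measurable_loss hℓL hf).aestronglyMeasurable (ℓ 0 + L * B) ?_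
  filter_upwards [ae_of_ae_map measurable_fst.aemeasurable hB] with z hz
  rw [Real.norm_of_nonneg (hℓ0 _)]
  exact loss_le hL hℓL z.2 hz

lemma lRisk_le_of_ae_abs_le [IsProbabilityMeasure ρ] (hL : 0 ≤ L) (hℓ0 : ∀ v, 0 ≤ ℓ v)
    (hℓL : ∀ v v', |ℓ v - ℓ v'| ≤ L * |v - v'|) {f : X → ℝ} (hf : Measurable f) {B : ℝ}
    (hB : ∀ᵐ x ∂ρ.fst, |f x| ≤ B) : lRisk ℓ ρ f ≤ ℓ 0 + L * B := by
  have h : lRisk ℓ ρ f ≤ ∫ _, (ℓ 0 + L * B) ∂ρ := by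
    refine integral_mono_ae (finiteRisk_of_ae_abs_le hL hℓ0 hℓL hf hB) (integrable_const _) ?_
    filter_upwards [ae_of_ae_map measurable_fst.aemeasurable hB] with z hz
    exact loss_le hL hℓL z.2 hz
  simpa using h

lemma lRisk_nonneg (hℓ0 : ∀ v, 0 ≤ ℓ v) (f : X → ℝ) : 0 ≤ lRisk ℓ ρ f :=
  integral_nonneg fun _ => hℓ0 _

/-- A function that is close in `L¹` to one of finite risk has finite risk, and the risks are
close. -/
lemma finiteRisk_and_lRisk_sub_le [IsFiniteMeasure ρ] (hL : 0 ≤ L)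
    (hℓL : ∀ v v', |ℓ v - ℓ v'| ≤ L * |v - v'|) {f g : X → ℝ} (hf : Measurable f)
    (hg : Measurable g) (hfr : FiniteRisk ℓ ρ f)
    (hfin : eLpNorm (fun x => f x - g x) 1 ρ.fst ≠ ∞) :
    FiniteRisk ℓ ρ g ∧
      lRisk ℓ ρ f - lRisk ℓ ρ g ≤ L * (eLpNorm (fun x => f x - g x) 1 ρ.fst).toReal := by
  have hint : Integrable (fun x => f x - g x) ρ.fst :=
    memLp_one_iff_integrable.1 ⟨(hf.sub hg).aestronglyMeasurable, hfin.lt_top⟩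
  have hint' : Integrable (fun z : X × Label => f z.1 - g z.1) ρ :=
    hint.comp_measurable measurable_fst
  have hd : Integrable (fun z : X × Label => ℓ ((z.2 : ℝ) * f z.1) - ℓ ((z.2 : ℝ) * g z.1)) ρ := by
    refine (hint'.abs.const_mul L).mono'
      ((measurable_loss hℓL hf).sub (measurable_loss hℓL hg)).aestronglyMeasurable ?_
    exact ae_of_all _ fun z => abs_loss_sub_le hL hℓL z.2 _ _
  have hgr : FiniteRisk ℓ ρ g := by
    have := Integrable.sub hfr hd
    refine this.congr (ae_of_all _ fun z => ?_)
    simp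
  refine ⟨hgr, ?_⟩
  have e : ∫ z, |f z.1 - g z.1| ∂ρ = (eLpNorm (fun x => f x - g x) 1 ρ.fst).toReal := by
    rw [eLpNorm_one_eq_lintegral_enorm, ← integral_norm_eq_lintegral_enorm hint.1,
      Measure.fst, integral_map measurable_fst.aemeasurable]
    · rfl
    · exact hint.1.norm
  rw [lRisk, lRisk, ← integral_sub hfr hgr, ← e, ← integral_const_mul]
  exact integral_mono hd (hint'.abs.const_mul L) fun z =>
    (le_abs_self _).trans (abs_loss_sub_le hL hℓL z.2 _ _)

end Loss

/-! ### Integrating out an independent variable. -/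

section Independence

lemma IndepFun.integral_comp_prodMk {Ω α ζ : Type*} [MeasurableSpace Ω] [MeasurableSpace α]
    [MeasurableSpace ζ] {μ : Measure Ω} [IsFiniteMeasure μ] {W : Ω → α} {Z : Ω → ζ}
    (hW : Measurable W) (hZ : Measurable Z) (hind : IndepFun W Z μ) {F : α × ζ → ℝ}
    (hF : Measurable F) (hint : Integrable (fun ω => F (W ω, Z ω)) μ) :
    ∫ ω, F (W ω, Z ω) ∂μ = ∫ ω, ∫ w, F (W ω, w) ∂(μ.map Z) ∂μ := by
  have hmap := hind.map_prod_eq_prod_map_map hW.aemeasurable hZ.aemeasurable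
  have hWZ : Measurable fun ω => (W ω, Z ω) := hW.prodMk hZ
  have hint' : Integrable F ((μ.map W).prod (μ.map Z)) := by
    rw [← hmap, integrable_map_measure hF.aestronglyMeasurable hWZ.aemeasurable]
    exact hint
  rw [← integral_map (f := F) hWZ.aemeasurable hF.aestronglyMeasurable, hmap,
    integral_prod _ hint', integral_map hW.aemeasurable]
  exact hF.stronglyMeasurable.integral_prod_right'.aestronglyMeasurable

/-- The identity, viewed as a map from `(Ω, m0)` to `(Ω, m)`, is a random variable generating `m`.
This reduces independence of a σ-algebra to independence of two variables. -/
lemma Indep.integral_comp_prodMk {Ω ζ : Type*} {m m0 : MeasurableSpace Ω} [mζ : MeasurableSpace ζ]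
    {μ : Measure[m0] Ω} [IsFiniteMeasure μ] (hm : m ≤ m0) {Z : Ω → ζ} (hZ : Measurable Z)
    (hind : Indep m (MeasurableSpace.comap Z mζ) μ) {F : Ω × ζ → ℝ}
    (hF : Measurable[m.prod mζ] F) (hint : Integrable (fun ω => F (ω, Z ω)) μ) :
    ∫ ω, F (ω, Z ω) ∂μ = ∫ ω, ∫ w, F (ω, w) ∂(μ.map Z) ∂μ := by
  have h : Indep (MeasurableSpace.comap id m) (MeasurableSpace.comap Z mζ) μ := by
    rw [MeasurableSpace.comap_id]
    exact hind
  exact @IndepFun.integral_comp_prodMk Ω Ω ζ m0 m mζ μ _ id Z (measurable_id'' hm) hZ h F hF hint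

end Independence

/-! ### The σ-algebra of past examples. -/

section Past

variable {X Ω : Type*} [MeasurableSpace X] {z : ℕ → Ω → X × Label}

/-- The `σ`-algebra generated by the examples preceding round `t`. -/
abbrev pastSigma (z : ℕ → Ω → X × Label) (t : ℕ) : MeasurableSpace Ω :=
  ⨆ i ∈ Set.Iio t, MeasurableSpace.comap (z i) inferInstance

lemma measurable_example_pastSigma {i t : ℕ} (hi : i < t) : Measurable[pastSigma z t] (z i) := by
  rw [measurable_iff_comap_le]
  exact le_iSup₂_of_le (f := fun i (_ : i ∈ Set.Iio t) =>
    MeasurableSpace.comap (z i) inferInstance) i hi le_rfl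

lemma IsSubgradientSequence.measurable_pastSigma {H : Type*} [NormedAddCommGroup H]
    [InnerProductSpace ℝ H] [CompleteSpace H] [RKHS ℝ H X ℝ] {ℓ : ℝ → ℝ} {a b L : ℝ}
    {s : ℕ → Ω → ℝ} (hs : IsSubgradientSequence (H := H) ℓ a b L z s)
    {i t : ℕ} (hi : i < t) : Measurable[pastSigma z t] (s i) := by
  refine (hs.nonanticipating i).mono (iSup₂_le fun j hj => ?_) le_rfl
  exact le_iSup₂_of_le (f := fun i (_ : i ∈ Set.Iio t) =>
    MeasurableSpace.comap (z i) inferInstance) j (lt_of_le_of_lt hj hi) le_rfl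

variable [mΩ : MeasurableSpace Ω] {μ : Measure Ω}

lemma pastSigma_le (hz : ∀ t, Measurable (z t)) (t : ℕ) : pastSigma z t ≤ mΩ :=
  iSup₂_le fun i _ => (hz i).comap_le

lemma indep_pastSigma (hz : ∀ t, Measurable (z t)) (hind : iIndepFun z μ) (t : ℕ) :
    Indep (pastSigma z t) (MeasurableSpace.comap (z t) inferInstance) μ := by
  have h := indep_iSup_of_disjoint (m := fun i => MeasurableSpace.comap (z i) inferInstance)
    (fun i => (hz i).comap_le) hind (S := Set.Iio t) (T := {t}) (by simp)
  simpa only [Set.mem_singleton_iff, iSup_iSup_eq_left] using h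

end Past

/-! ### From regret to expected risk. -/

section OnlineToBatch

variable {X : Type*} [MeasurableSpace X] {H : Type*} [NormedAddCommGroup H]
  [InnerProductSpace ℝ H] [CompleteSpace H] [RKHS ℝ H X ℝ] {ℓ : ℝ → ℝ} {a b L : ℝ}
  {ρ : Measure (X × Label)}

lemma lRisk_pistolAverage_le (hℓc : ConvexOn ℝ Set.univ ℓ) (hfr : ∀ f : H, FiniteRisk ℓ ρ (f : X → ℝ))
    (k : ℕ → H) (s : ℕ → ℝ) {T : ℕ} (hT : 1 ≤ T) :
    lRisk ℓ ρ (pistolAverage a b L k s T : H)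
      ≤ (T : ℝ)⁻¹ * ∑ t ∈ range T, lRisk ℓ ρ (pistolIterate a b L k s t : H) := by
  have hT0 : (T : ℝ) ≠ 0 := by positivity
  simp only [lRisk]
  rw [← integral_finsetSum _ fun t _ => hfr _, ← integral_const_mul]
  refine integral_mono (hfr _) ((integrable_finsetSum _ fun t _ => hfr _).const_mul _) fun w => ?_
  have h := hℓc.map_sum_le (t := range T) (w := fun _ => (T : ℝ)⁻¹)
    (p := fun t => (w.2 : ℝ) * pistolIterate a b L k s t w.1) (fun _ _ => by positivity)
    (by simp [hT0]) (fun _ _ => Set.mem_univ _)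
  simp only [smul_eq_mul, ← mul_sum] at h
  simp only [pistolAverage_apply, smul_eq_mul, ← mul_sum]
  rwa [mul_left_comm]

lemma measurable_loss_uncurry {Ω : Type*} {m : MeasurableSpace Ω}
    (hℓL : ∀ v v', |ℓ v - ℓ v'| ≤ L * |v - v'|) {G : Ω → X → ℝ}
    (hG : Measurable fun p : Ω × X => G p.1 p.2) :
    Measurable fun p : Ω × (X × Label) => ℓ ((p.2.2 : ℝ) * G p.1 p.2.1) := by
  have h2 : Measurable fun p : Ω × (X × Label) => (p.1, p.2.1) :=
    measurable_fst.prodMk (measurable_fst.comp measurable_snd)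
  have h3 : Measurable fun p : Ω × (X × Label) => (p.2.2 : ℝ) :=
    measurable_subtype_coe.comp (measurable_snd.comp measurable_snd)
  exact (continuous_of_abs_sub_le hℓL).measurable.comp (h3.mul (hG.comp h2))

variable [TopologicalSpace X] [BorelSpace X] {K : X → X → ℝ}

lemma IsRKHSOf.finiteRisk [IsFiniteMeasure ρ] (hK : IsRKHSOf H K) (hM : IsMercerKernel K)
    (hL : 0 ≤ L) (hℓ0 : ∀ v, 0 ≤ ℓ v) (hℓL : ∀ v v', |ℓ v - ℓ v'| ≤ L * |v - v'|)
    (hk : ∀ᵐ x ∂ρ.fst, ‖kerSection H x‖ ≤ 1) (f : H) : FiniteRisk ℓ ρ f := by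
  refine finiteRisk_of_ae_abs_le hL hℓ0 hℓL (hK.continuous_apply hM f).measurable (B := ‖f‖) ?_
  filter_upwards [hk] with x hx
  exact (abs_apply_le_norm_mul x f).trans (mul_le_of_le_one_left (norm_nonneg _) hx)

lemma IsRKHSOf.lRisk_le [IsProbabilityMeasure ρ] (hK : IsRKHSOf H K) (hM : IsMercerKernel K)
    (hL : 0 ≤ L) (hℓ0 : ∀ v, 0 ≤ ℓ v) (hℓL : ∀ v v', |ℓ v - ℓ v'| ≤ L * |v - v'|)
    (hk : ∀ᵐ x ∂ρ.fst, ‖kerSection H x‖ ≤ 1) (f : H) : lRisk ℓ ρ f ≤ ℓ 0 + L * ‖f‖ := by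
  refine lRisk_le_of_ae_abs_le hL hℓ0 hℓL (hK.continuous_apply hM f).measurable ?_
  filter_upwards [hk] with x hx
  exact (abs_apply_le_norm_mul x f).trans (mul_le_of_le_one_left (norm_nonneg _) hx)

variable [SecondCountableTopology X] {Ω : Type*} [mΩ : MeasurableSpace Ω] {μ : Measure Ω}
  {z : ℕ → Ω → X × Label} {s : ℕ → Ω → ℝ}

/-- Online-to-batch conversion: the excess risk of the averaged solution over a competitor is
controlled by the regret. -/
theorem IsSubgradientSequence.integral_lRisk_pistolSolution_le [IsProbabilityMeasure ρ]
    [IsProbabilityMeasure μ] (hK : IsRKHSOf H K) (hM : IsMercerKernel K)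
    (hL : 0 < L) (ha : 2.25 * L ≤ a) (hb : 0 < b) (hℓ0 : ∀ v, 0 ≤ ℓ v)
    (hℓc : ConvexOn ℝ Set.univ ℓ) (hℓL : ∀ v v', |ℓ v - ℓ v'| ≤ L * |v - v'|)
    (hk : ∀ᵐ x ∂ρ.fst, ‖kerSection H x‖ ≤ 1) (hz : ∀ t, Measurable (z t))
    (hind : iIndepFun z μ) (hρ : ∀ t, μ.map (z t) = ρ)
    (hs : IsSubgradientSequence (H := H) ℓ a b L z s) {T : ℕ} (hT : 1 ≤ T) :
    Integrable (fun ω => lRisk ℓ ρ (pistolSolution H a b L z s T ω)) μ ∧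
      ∀ h : H, ∫ ω, lRisk ℓ ρ (pistolSolution H a b L z s T ω) ∂μ - lRisk ℓ ρ h
        ≤ pistolRegretBound a b L T ‖h‖ / T := by
  have ha0 : 0 < a := by norm_num at ha; linarith
  have hfr := hK.finiteRisk hM hL.le hℓ0 hℓL hk
  have hT0 : (0 : ℝ) < T := by positivity
  set it : ℕ → Ω → H := fun t ω =>
    pistolIterate a b L (fun i => kerSection H (z i ω).1) (fun i => s i ω) t with hit
  have hsL : ∀ t ω, |s t ω| ≤ L := fun t ω => (hs.subgradient t ω).abs_le hL.le hℓL
  have hkae : ∀ᵐ ω ∂μ, ∀ t, ‖kerSection H (z t ω).1‖ ≤ 1 := by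
    refine ae_all_iff.2 fun t => ?_
    refine ae_of_ae_map (hz t).aemeasurable (p := fun w => ‖kerSection H w.1‖ ≤ 1) ?_
    rw [hρ t]
    exact ae_of_ae_map measurable_fst.aemeasurable hk
  have hit_past : ∀ t, Measurable[(pastSigma z t).prod inferInstance]
      fun p : Ω × X => it t p.1 p.2 := fun t =>
    @IsRKHSOf.measurable_pistolIterate_apply X H _ _ _ _ K _ _ _ _ Ω (pastSigma z t) hK hM a b L
      (fun i ω => (z i ω).1) s t
      (fun i hi => measurable_fst.comp (measurable_example_pastSigma hi))
      (fun i hi => hs.measurable_pastSigma hi)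
  have hit_m : ∀ t, Measurable fun p : Ω × X => it t p.1 p.2 := fun t =>
    (hit_past t).mono (sup_le_sup (MeasurableSpace.comap_mono (pastSigma_le hz t)) le_rfl) le_rfl
  have hm : ∀ t, Measurable fun p : Ω × (X × Label) => ℓ ((p.2.2 : ℝ) * it t p.1 p.2.1) := fun t =>
    measurable_loss_uncurry hℓL (G := fun ω x => it t ω x) (hit_m t)
  -- The bound is exponential in `t²`, up to lower-order factors; it serves only for integrability
  -- and never enters the rate.
  have hnorm : ∀ t, ∃ B, ∀ᵐ ω ∂μ, ‖it t ω‖ ≤ B := fun t => ⟨_, by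
    filter_upwards [hkae] with ω hω
    exact norm_pistolIterate_le ha0 hL hb t (fun i _ => hω i) (fun i _ => hsL i ω)⟩
  choose B hB using hnorm
  have hRint : ∀ t, Integrable (fun ω => lRisk ℓ ρ (it t ω)) μ := fun t => by
    refine Integrable.of_bound (hm t).stronglyMeasurable.integral_prod_right'.aestronglyMeasurable
      (ℓ 0 + L * B t) ?_
    filter_upwards [hB t] with ω hω
    rw [Real.norm_of_nonneg (lRisk_nonneg hℓ0 _)]
    refine (hK.lRisk_le hM hL.le hℓ0 hℓL hk _).trans ?_
    gcongr
  have hlint : ∀ t, Integrable (fun ω => ℓ (((z t ω).2 : ℝ) * it t ω (z t ω).1)) μ := fun t => by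
    refine Integrable.of_bound ((hm t).comp (measurable_id.prodMk (hz t))).aestronglyMeasurable
      (ℓ 0 + L * B t) ?_
    filter_upwards [hB t, hkae] with ω hω hω'
    rw [Real.norm_of_nonneg (hℓ0 _)]
    refine loss_le hL.le hℓL _ ((abs_apply_le_norm_mul _ _).trans ?_)
    exact (mul_le_of_le_one_left (norm_nonneg _) (hω' t)).trans hω
  -- The iterate is measurable with respect to the past and `z t` is a fresh sample of `ρ`, so
  -- integrating out `z t` turns the loss into the risk.
  have heq : ∀ t, ∫ ω, ℓ (((z t ω).2 : ℝ) * it t ω (z t ω).1) ∂μ = ∫ ω, lRisk ℓ ρ (it t ω) ∂μ :=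
    fun t => by
      have h := Indep.integral_comp_prodMk (pastSigma_le hz t) (hz t) (indep_pastSigma hz hind t)
        (measurable_loss_uncurry (m := pastSigma z t) hℓL (G := fun ω x => it t ω x) (hit_past t)) (hlint t)
      rw [hρ t] at h
      exact h
  have hsolint : Integrable (fun ω => lRisk ℓ ρ (pistolSolution H a b L z s T ω)) μ := by
    have hsol_m : Measurable fun p : Ω × X => pistolSolution H a b L z s T p.1 p.2 := by
      simp only [pistolSolution, pistolAverage_apply, smul_eq_mul]
      exact Finset.measurable_sum _ fun t _ => (hit_m t).const_mul _
    have hsm := measurable_loss_uncurry hℓL (G := fun ω x => pistolSolution H a b L z s T ω x) hsol_m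
    refine Integrable.mono' (((integrable_finsetSum (range T) fun t _ => hRint t)).const_mul
      (T : ℝ)⁻¹) hsm.stronglyMeasurable.integral_prod_right'.aestronglyMeasurable ?_
    refine ae_of_all _ fun ω => ?_
    rw [Real.norm_of_nonneg (lRisk_nonneg hℓ0 _)]
    exact lRisk_pistolAverage_le hℓc hfr _ _ hT
  refine ⟨hsolint, fun h => ?_⟩
  have hh : ∀ t, Integrable (fun ω => ℓ (((z t ω).2 : ℝ) * h (z t ω).1)) μ ∧
      ∫ ω, ℓ (((z t ω).2 : ℝ) * h (z t ω).1) ∂μ = lRisk ℓ ρ h := fun t => by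
    have hmeas : Measurable fun w : X × Label => ℓ ((w.2 : ℝ) * h w.1) :=
      measurable_loss hℓL (hK.continuous_apply hM h).measurable
    constructor
    · have := hfr h
      rw [FiniteRisk, ← hρ t, integrable_map_measure hmeas.aestronglyMeasurable
        (hz t).aemeasurable] at this
      exact this
    · rw [lRisk, ← hρ t, integral_map (hz t).aemeasurable hmeas.aestronglyMeasurable]
  have hreg : ∑ t ∈ range T, ∫ ω, lRisk ℓ ρ (it t ω) ∂μ - T * lRisk ℓ ρ h
      ≤ pistolRegretBound a b L T ‖h‖ := by
    have e : ∑ t ∈ range T, ∫ ω, lRisk ℓ ρ (it t ω) ∂μ - T * lRisk ℓ ρ h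
        = ∫ ω, ∑ t ∈ range T, (ℓ (((z t ω).2 : ℝ) * it t ω (z t ω).1)
          - ℓ (((z t ω).2 : ℝ) * h (z t ω).1)) ∂μ := by
      have e' : ∀ t, ∫ ω, (ℓ (((z t ω).2 : ℝ) * it t ω (z t ω).1)
          - ℓ (((z t ω).2 : ℝ) * h (z t ω).1)) ∂μ
          = ∫ ω, lRisk ℓ ρ (it t ω) ∂μ - lRisk ℓ ρ h := fun t => by
        rw [integral_sub (hlint t) (hh t).1, heq, (hh t).2]
      rw [integral_finsetSum (range T) (f := fun t ω => ℓ (((z t ω).2 : ℝ) * it t ω (z t ω).1)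
          - ℓ (((z t ω).2 : ℝ) * h (z t ω).1)) fun t _ => (hlint t).sub (hh t).1]
      simp only [e', sum_sub_distrib, sum_const, card_range, nsmul_eq_mul]
    rw [e]
    have hle : ∫ ω, ∑ t ∈ range T, (ℓ (((z t ω).2 : ℝ) * it t ω (z t ω).1)
          - ℓ (((z t ω).2 : ℝ) * h (z t ω).1)) ∂μ
        ≤ ∫ _, pistolRegretBound a b L T ‖h‖ ∂μ := by
      refine integral_mono_ae (integrable_finsetSum _ fun t _ => (hlint t).sub (hh t).1)
        (integrable_const _) ?_
      filter_upwards [hkae] with ω hω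
      refine le_trans (sum_le_sum fun t _ => ?_) (pistol_regret_le hL ha hb T
        (k := fun i => kerSection H (z i ω).1) (s := fun i => s i ω)
        (fun t _ => hω t) (fun t _ => hsL t ω) h)
      rw [inner_kerSection, inner_kerSection]
      have := hs.subgradient t ω (h (z t ω).1)
      simp only [hit] at this ⊢
      linarith
    simpa using hle
  have hmono : ∫ ω, lRisk ℓ ρ (pistolSolution H a b L z s T ω) ∂μ
      ≤ (T : ℝ)⁻¹ * ∑ t ∈ range T, ∫ ω, lRisk ℓ ρ (it t ω) ∂μ := by
    rw [← integral_finsetSum _ fun t _ => hRint t, ← integral_const_mul]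
    refine integral_mono hsolint ((integrable_finsetSum _ fun t _ => hRint t).const_mul _)
      fun ω => ?_
    exact lRisk_pistolAverage_le hℓc hfr _ _ hT
  rw [le_div_iff₀ hT0, sub_mul]
  have := mul_le_mul_of_nonneg_left hmono hT0.le
  rw [mul_inv_cancel_left₀ hT0.ne'] at this
  linarith

end OnlineToBatch

/-! ### Choice of the competitor and the final rate. -/

lemma half_le_log_one_add_natCast {T : ℕ} (hT : 1 ≤ T) : 1 / 2 ≤ Real.log (1 + T) := by
  have h1 : (1 : ℝ) ≤ T := by exact_mod_cast hT
  have h2 := Real.log_le_log (by norm_num : (0 : ℝ) < 2) (by linarith : (2 : ℝ) ≤ 1 + T)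
  linarith [Real.log_two_gt_d9]

/-- The rate of the regret per round against competitors whose squared norm grows at most like
`T ^ ((1 - β) / (β + 1))`. -/
lemma pistolRegretBound_div_le {β C L a b U : ℝ} (hβ0 : 0 < β) (hC : 0 < C) (hL : 0 < L)
    (ha : 0 < a) (hb : 0 < b) {T : ℕ} (hT : 1 ≤ T) (hU0 : 0 ≤ U)
    (hU : U ^ 2 ≤ 2 * C * (T : ℝ) ^ ((1 - β) / (β + 1))) :
    pistolRegretBound a b L T U / T
      ≤ (2 * b + 60 * Real.exp 16 * b + 2
          + 8 * C * a * L * (2 + 2 * Real.log (1 + √(2 * C) * L / b)))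
        * Real.log (1 + T) * (T : ℝ) ^ (-(β / (β + 1))) := by
  have hT1 : (1 : ℝ) ≤ T := by exact_mod_cast hT
  have hT0 : (0 : ℝ) < T := by linarith
  have hβ : 0 < β + 1 := by linarith
  have hl := half_le_log_one_add_natCast hT
  set l := Real.log (1 + T) with hldef
  set r := (T : ℝ) ^ (-(β / (β + 1))) with hr
  have hr0 : 0 < r := Real.rpow_pos_of_pos hT0 _
  set D := √(2 * C) * L / b with hD
  have hD0 : 0 ≤ D := by positivity
  have hlogD : 0 ≤ Real.log (1 + D) := Real.log_nonneg (by linarith)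
  set E := 2 + 2 * Real.log (1 + D) with hE
  have hE0 : 0 < E := by linarith
  have hinv : 1 / (T : ℝ) ≤ r := by
    rw [one_div, ← Real.rpow_neg_one]
    refine Real.rpow_le_rpow_of_exponent_le hT1 (neg_le_neg ?_)
    rw [div_le_one hβ]
    linarith
  -- A crude bound suffices here, because it is used only inside the logarithm.
  have hUT : U ≤ √(2 * C) * T := by
    rw [← Real.sqrt_sq hU0, ← Real.sqrt_sq hT0.le, ← Real.sqrt_mul (by positivity)]
    refine Real.sqrt_le_sqrt (hU.trans (mul_le_mul_of_nonneg_left ?_ (by positivity)))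
    rw [← Real.rpow_two]
    refine Real.rpow_le_rpow_of_exponent_le hT1 ?_
    rw [div_le_iff₀ hβ]
    linarith
  have hlog : Real.log (1 + U * (L * T) / b) ≤ E * l := by
    have h1 : 1 + U * (L * T) / b ≤ (1 + D) * (1 + T) ^ 2 := by
      have h2 : U * (L * T) / b ≤ √(2 * C) * T * (L * T) / b := by gcongr
      have h3 : √(2 * C) * T * (L * T) / b = D * (T : ℝ) ^ 2 := by rw [hD]; ring
      nlinarith [mul_nonneg hD0 hT0.le]
    have h4 := Real.log_le_log (by positivity) h1
    rw [Real.log_mul (by positivity) (by positivity), Real.log_pow] at h4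
    push_cast at h4
    nlinarith
  have hsqrt : U * √(2 * (a * L * (1 + T)) * Real.log (1 + U * (L * T) / b)) / T
      ≤ (1 + 8 * C * a * L * E * l) * r := by
    have hrpow : (T : ℝ) ^ ((1 - β) / (β + 1)) = T * r ^ 2 := by
      rw [hr, ← Real.rpow_natCast, ← Real.rpow_mul hT0.le]
      nth_rewrite 2 [← Real.rpow_one (T : ℝ)]
      rw [← Real.rpow_add hT0]
      congr 1
      push_cast
      field_simp
      ring
    have hx : 0 ≤ 8 * C * a * L * E * l := by positivity
    rw [div_le_iff₀ hT0]
    -- After squaring, the left side is at most `x (r T)²` with `x = 8CaLEl`. Using `x ≤ (1 + x)²`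
    -- in place of `√x` leaves a single power of the logarithm.
    refine abs_le_of_sq_le_sq' ?_ (by positivity) |>.2
    have hlog0 : 0 ≤ Real.log (1 + U * (L * T) / b) :=
      Real.log_nonneg (le_add_of_nonneg_right (by positivity))
    rw [mul_pow, Real.sq_sqrt (by positivity)]
    calc U ^ 2 * (2 * (a * L * (1 + T)) * Real.log (1 + U * (L * T) / b))
        ≤ 2 * C * (T * r ^ 2) * (2 * (a * L * (T + T)) * (E * l)) := by
          rw [← hrpow]
          gcongr
      _ = 8 * C * a * L * E * l * (r * T) ^ 2 := by ring
      _ ≤ (1 + 8 * C * a * L * E * l) ^ 2 * (r * T) ^ 2 := by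
          gcongr
          nlinarith
      _ = _ := by ring
  have hb1 : b * (1 / T) ≤ 2 * b * l * r := by
    calc b * (1 / T) ≤ b * r := by gcongr
      _ ≤ 2 * b * l * r := by nlinarith [mul_pos hb hr0]
  have hb2 : 60 * Real.exp 16 * b * l * (1 / T) ≤ 60 * Real.exp 16 * b * l * r := by gcongr
  have hb3 : r ≤ 2 * l * r := by nlinarith
  rw [pistolRegretBound, add_div, add_div]
  calc _ ≤ 2 * b * l * r + 60 * Real.exp 16 * b * l * r + (1 + 8 * C * a * L * E * l) * r := by
        refine add_le_add (add_le_add ?_ ?_) hsqrt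
        · rwa [div_eq_mul_one_div]
        · rwa [div_eq_mul_one_div]
    _ ≤ _ := by linarith

/-- A near-minimizer of the regularized approximation error. -/
lemma exists_eLpNorm_le_and_norm_sq_le {X H : Type*} [MeasurableSpace X] [NormedAddCommGroup H]
    [InnerProductSpace ℝ H] [RKHS ℝ H X ℝ] {ν : Measure X} {g : X → ℝ} {C β γ : ℝ} (hC : 0 < C)
    (hγ : 0 < γ)
    (h : ⨅ f : H, (eLpNorm (fun x => f x - g x) 1 ν + ENNReal.ofReal (γ * ‖f‖ ^ 2))
      ≤ ENNReal.ofReal (C * γ ^ β)) :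
    ∃ f : H, eLpNorm (fun x => f x - g x) 1 ν ≠ ∞ ∧
      (eLpNorm (fun x => f x - g x) 1 ν).toReal ≤ 2 * C * γ ^ β ∧
      ‖f‖ ^ 2 ≤ 2 * C * γ ^ β / γ := by
  have hpos : 0 < C * γ ^ β := mul_pos hC (Real.rpow_pos_of_pos hγ _)
  -- Doubling the bound makes it strict, so some `f` lies below it without the infimum having to be
  -- attained.
  have h2 : ENNReal.ofReal (C * γ ^ β) < ENNReal.ofReal (2 * C * γ ^ β) :=
    (ENNReal.ofReal_lt_ofReal_iff (by linarith)).2 (by linarith)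
  obtain ⟨f, hf⟩ := iInf_lt_iff.1 (h.trans_lt h2)
  have h3 := le_self_add.trans_lt hf
  have h4 := le_add_self.trans_lt hf
  refine ⟨f, (h3.trans ENNReal.ofReal_lt_top).ne, ?_, ?_⟩
  · exact ENNReal.toReal_le_of_le_ofReal (by linarith) h3.le
  · rw [le_div_iff₀ hγ, mul_comm]
    exact (ENNReal.ofReal_le_ofReal_iff (by linarith)).1 h4.le

theorem theorem3
    (β C L a b ℓ₀ : ℝ) (hβ0 : 0 < β) (hβ1 : β ≤ 1) (hC : 0 < C) (hL : 0 < L)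
    (ha : 2.25 * L ≤ a) (hb : 0 < b) :
    ∃ (c : ℝ) (p : ℕ),
      ∀ (d : ℕ) (X : Set (EuclideanSpace ℝ (Fin d))) (_ : IsCompact X)
        (K : X → X → ℝ) (_ : IsMercerKernel K)
        (H : Type*) [NormedAddCommGroup H] [InnerProductSpace ℝ H] [CompleteSpace H]
        [RKHS ℝ H X ℝ] (_ : IsRKHSOf H K)
        (ℓ : ℝ → ℝ) (_ : ∀ v, 0 ≤ ℓ v) (_ : ConvexOn ℝ Set.univ ℓ)
        (_ : ∀ v v', |ℓ v - ℓ v'| ≤ L * |v - v'|) (_ : ℓ 0 = ℓ₀)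
        (ρ : Measure (X × Label)) [IsProbabilityMeasure ρ]
        (_ : ∀ᵐ x ∂ρ.fst, ‖kerSection H x‖ ≤ 1)
        (fρ : X → ℝ) (_ : IsOptimalPredictor ℓ ρ fρ)
        (_ : ∀ γ : ℝ, 0 < γ →
          ⨅ f : H, (eLpNorm (fun x => f x - fρ x) 1 ρ.fst + ENNReal.ofReal (γ * ‖f‖ ^ 2))
            ≤ ENNReal.ofReal (C * γ ^ β))
        (Ω : Type*) [MeasurableSpace Ω] (μ : Measure Ω) [IsProbabilityMeasure μ]
        (z : ℕ → Ω → X × Label) (_ : ∀ t, Measurable (z t)) (_ : iIndepFun z μ)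
        (_ : ∀ t, μ.map (z t) = ρ)
        (s : ℕ → Ω → ℝ) (_ : IsSubgradientSequence (H := H) ℓ a b L z s),
        FiniteRisk ℓ ρ fρ ∧ (∀ f : H, FiniteRisk ℓ ρ f) ∧
          ∀ T : ℕ, 1 ≤ T →
            Integrable (fun ω => lRisk ℓ ρ (pistolSolution H a b L z s T ω)) μ ∧
            (∫ ω, lRisk ℓ ρ (pistolSolution H a b L z s T ω) ∂μ) - lRisk ℓ ρ fρ
              ≤ c * Real.log (1 + T) ^ p * (T : ℝ) ^ (-(β / (β + 1))) := by
  have ha0 : 0 < a := by norm_num at ha; linarith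
  refine ⟨4 * C * L + (2 * b + 60 * Real.exp 16 * b + 2
    + 8 * C * a * L * (2 + 2 * Real.log (1 + √(2 * C) * L / b))), 1, ?_⟩
  intro d X _ K hM H _ _ _ _ hK ℓ hℓ0 hℓc hℓL _ ρ _ hk fρ hopt happrox Ω _ μ _ z hz hind hρ s hs
  have hfr : ∀ f : H, FiniteRisk ℓ ρ f := hK.finiteRisk hM hL.le hℓ0 hℓL hk
  have hcmp : ∀ f : H, eLpNorm (fun x => f x - fρ x) 1 ρ.fst ≠ ∞ → FiniteRisk ℓ ρ fρ ∧
      lRisk ℓ ρ f - lRisk ℓ ρ fρ ≤ L * (eLpNorm (fun x => f x - fρ x) 1 ρ.fst).toReal :=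
    fun f hf => finiteRisk_and_lRisk_sub_le hL.le hℓL (hK.continuous_apply hM f).measurable
      hopt.1 (hfr f) hf
  refine ⟨?_, hfr, fun T hT => ?_⟩
  -- Any `γ` would do: one `f` in `H` at finite `L¹` distance from `fρ` carries its finite risk
  -- over.
  · obtain ⟨f, hf, -⟩ := exists_eLpNorm_le_and_norm_sq_le hC one_pos (happrox 1 one_pos)
    exact (hcmp f hf).1
  · obtain ⟨hint, hregret⟩ := hs.integral_lRisk_pistolSolution_le hK hM hL ha hb hℓ0 hℓc hℓL hk hz
      hind hρ hT
    refine ⟨hint, ?_⟩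
    have hT0 : (0 : ℝ) < T := by exact_mod_cast hT
    have hβ : β + 1 ≠ 0 := by linarith
    set γ := (T : ℝ) ^ (-(1 / (β + 1))) with hγ
    have hγ0 : 0 < γ := Real.rpow_pos_of_pos hT0 _
    have hγβ : γ ^ β = (T : ℝ) ^ (-(β / (β + 1))) := by
      rw [hγ, ← Real.rpow_mul hT0.le]
      congr 1
      ring
    obtain ⟨f, hf, hf1, hf2⟩ := exists_eLpNorm_le_and_norm_sq_le hC hγ0 (happrox γ hγ0)
    have hnorm : ‖f‖ ^ 2 ≤ 2 * C * (T : ℝ) ^ ((1 - β) / (β + 1)) := by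
      rw [mul_div_assoc, hγβ, hγ, ← Real.rpow_sub hT0] at hf2
      convert hf2 using 3
      field_simp
      ring
    have h1 := pistolRegretBound_div_le hβ0 hC hL ha0 hb hT (norm_nonneg f) hnorm
    have h2 := hregret f
    have h3 := (hcmp f hf).2
    have h4 := mul_le_mul_of_nonneg_left hf1 hL.le
    rw [hγβ] at h4
    -- The approximation term has no logarithm; `1 ≤ 2 log (1 + T)` supplies one and turns `2CL`
    -- into `4CL`.
    have h5 : L * (2 * C * (T : ℝ) ^ (-(β / (β + 1))))
        ≤ 4 * C * L * Real.log (1 + T) * (T : ℝ) ^ (-(β / (β + 1))) := by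
      have h6 : 0 ≤ 2 * C * L * (T : ℝ) ^ (-(β / (β + 1))) := by positivity
      have := mul_le_mul_of_nonneg_right (half_le_log_one_add_natCast hT) h6
      linarith
    rw [pow_one, add_mul, add_mul]
    linarith
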